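/- Write a CSS code with check matrices $H_X\in\mathbb F_2^{m_X\times n}$, $H_Z\in\mathbb F_2^{m_Z\times n}$, $H_XH_Z^{\intercal}=0$, as the based chain complex $C_\bullet=(\mathbb F_2^{m_Z}\xrightarrow{H_Z^{\intercal}}\mathbb F_2^{n}\xrightarrow{H_X}\mathbb F_2^{m_X})$ in degrees $2,1,0$. Its distance is the minimum Hamming weight of the vectors in $\ker H_X\setminus\operatorname{im}H_Z^{\intercal}$ and in $\ker H_Z\setminus\operatorname{im}H_X^{\intercal}$ ($\infty$ if there are none). A stabiliser code $Q$ on $n$ qubits with generators $S_1,\dots,S_m$ has soundness $\rho$ if $$\frac1m\sum_{i=1}^m\tfrac12(I-S_i)\succeq\frac{\rho}{n}\sum_{t\ge1}t\,(\Pi_{Q_t}-\Pi_{Q_{t-1}}),$$ where $\Pi_{Q_t}$ is the orthogonal projection onto the span $Q_t$ of the states $(M_1\otimes\cdots\otimes M_n)\psi$ with $\psi\in Q$ and at most $t$ of the $M_i$ different from $I$. Let $A_\bullet$ be a CSS code with $n_A>0$ qubits, $m_X$ $X$-checks, $m_Z$ $Z$-checks and $m_A=m_X+m_Z>0$ checks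 in total, and suppose that it has quantum soundness $\rho_A>0$ (for some locality). Let $C^{(j)}_\bullet$, $j\in J$ ($J$ finite), be CSS codes and let $f^{(j)}_\bullet:A_\bullet\to C^{(j)}_\bullet$ be injective chain maps that send each qubit, $X$-check and $Z$-check of $A$ to a single qubit, $X$-check and $Z$-check of $C^{(j)}$. Let $\mathcal H$ be the hypergraph whose vertices are the qubits of $A$, whose hyperedges are the $X$-checks of $A$, and whose incidence matrix is $G=H_X(A)^{\intercal}$. For a natural number $L$ let $\mathcal H_L=\mathcal H\,\square\,\mathcal J_L$ be $\mathcal H$ thickened $L$ times, where $\mathcal J_L$ is the path with $L$ vertices and $L-1$ edges; thus $\mathcal H_L$ has $Ln_A$ vertices and $Lm_X+(L-1)n_A$ hyperedges. For any levels $\ell_j\in\{1,\dots,L\}$, and any cycle basis $N$ of $\mathcal H_L$ (an injective matrix whose image is the kernel of the incidence matrix of $\mathcal H_L$), let $D$ be the deformed code: the mapping cone of $\sum_jf^{(j)}_\bullet$, with $f^{(j)}$ attached at level $\ell_j$ of $\mathcal H_L$, so that the hyperedges of $\mathcal H_L$ are new qubits and its vertices are new $Z$-checks, together with one new $X$-check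 for each cycle in the basis $N$ (all cycles are gauge-fixed). (1) If $L\ge\frac{2n_A}{\rho_Am_A}$ and every $C^{(j)}$ has distance at least $d$, then $D$ has distance at least $d$. (2) For each $\sigma\in\mathbb N$ there is a constant $c>0$, depending only on $\sigma$, such that if all row and column weights of the check matrices of $A$ are at most $\sigma$, and $A$ has distance at least $2$ or each qubit of $A$ lies in the support of some check of $A$, then for $L=\lceil\frac{2n_A}{\rho_Am_A}\rceil$ the total number of new qubits, new $Z$-checks and new cycle checks is at most $c\,\frac{n_A}{\rho_A}$. -/

import Mathlib

open Matrix
open scoped Kronecker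

noncomputable section

/-! ### CSS codes, logical operators and distance -/

/-- A CSS code with qubits `Q`, `X`-checks `X` and `Z`-checks `Z`; equivalently the based chain
complex `𝔽₂^Z --HZᵀ--> 𝔽₂^Q --HX--> 𝔽₂^X` (in degrees 2, 1, 0). -/
structure CSSCode (Q X Z : Type*) [Fintype Q] where
  HX : Matrix X Q (ZMod 2)
  HZ : Matrix Z Q (ZMod 2)
  comm : HX * HZᵀ = 0

namespace CSSCode

variable {Q X Z : Type*} [Fintype Q] [Fintype X] [Fintype Z]

/-- The minimum weight of a nontrivial logical `Z` operator, `⊤` if there is none. -/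
def distZ (C : CSSCode Q X Z) : ℕ∞ :=
  ⨅ (v : Q → ZMod 2) (_ : C.HX *ᵥ v = 0) (_ : ¬ ∃ w : Z → ZMod 2, C.HZᵀ *ᵥ w = v),
    (hammingNorm v : ℕ∞)

/-- The minimum weight of a nontrivial logical `X` operator, `⊤` if there is none. -/
def distX (C : CSSCode Q X Z) : ℕ∞ :=
  ⨅ (u : Q → ZMod 2) (_ : C.HZ *ᵥ u = 0) (_ : ¬ ∃ w : X → ZMod 2, C.HXᵀ *ᵥ w = u),
    (hammingNorm u : ℕ∞)

/-- The code distance. -/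
def distance (C : CSSCode Q X Z) : ℕ∞ := min C.distX C.distZ

/-- All row and column weights of both check matrices are at most `σ`. -/
def IsSparse (C : CSSCode Q X Z) (σ : ℕ) : Prop :=
  (∀ i, hammingNorm (C.HX i) ≤ σ) ∧ (∀ q, hammingNorm (C.HXᵀ q) ≤ σ) ∧
  (∀ i, hammingNorm (C.HZ i) ≤ σ) ∧ (∀ q, hammingNorm (C.HZᵀ q) ≤ σ)

/-- Every qubit lies in the support of at least one check. -/
def EveryQubitChecked (C : CSSCode Q X Z) : Prop :=
  ∀ q, (∃ i, C.HX i q ≠ 0) ∨ (∃ i, C.HZ i q ≠ 0)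

end CSSCode

/-! ### Quantum soundness -/

/-- The Hilbert space of a set `Q` of qubits, with computational basis `𝔽₂^Q`. -/
abbrev QubitSpace (Q : Type*) [Fintype Q] : Type _ := EuclideanSpace ℂ (Q → ZMod 2)

section Operators

variable {Q : Type*} [Fintype Q] [DecidableEq Q]

/-- The product operator `⨂ q, M q`. -/
def tensorOp (M : Q → Matrix (ZMod 2) (ZMod 2) ℂ) : QubitSpace Q →L[ℂ] QubitSpace Q :=
  Matrix.toEuclideanCLM (n := Q → ZMod 2) (𝕜 := ℂ)
    (Matrix.of fun x y => ∏ q, M q (x q) (y q))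

/-- The one-qubit Pauli matrix `X`. -/
def pauliMatX : Matrix (ZMod 2) (ZMod 2) ℂ := Matrix.of fun x y => if x = y then 0 else 1

/-- The one-qubit Pauli matrix `Z`. -/
def pauliMatZ : Matrix (ZMod 2) (ZMod 2) ℂ :=
  Matrix.diagonal fun x => if x = 0 then 1 else -1

/-- The Pauli operator `X(u)`. -/
def pauliX (u : Q → ZMod 2) : QubitSpace Q →L[ℂ] QubitSpace Q :=
  tensorOp fun q => if u q = 0 then 1 else pauliMatX

/-- The Pauli operator `Z(v)`. -/
def pauliZ (v : Q → ZMod 2) : QubitSpace Q →L[ℂ] QubitSpace Q :=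
  tensorOp fun q => if v q = 0 then 1 else pauliMatZ

variable {K : Type*}

/-- The common `+1` eigenspace of a family of operators (the generators of a stabiliser group). -/
def codeSpace (S : K → (QubitSpace Q →L[ℂ] QubitSpace Q)) : Submodule ℂ (QubitSpace Q) :=
  ⨅ i, LinearMap.eqLocus (S i : QubitSpace Q →ₗ[ℂ] QubitSpace Q) LinearMap.id

open Classical in
/-- The `t`-fattening of a code space: the span of the states obtained from code states by product
operators that differ from the identity on at most `t` qubits. -/
def fattening (W : Submodule ℂ (QubitSpace Q)) (t : ℕ) : Submodule ℂ (QubitSpace Q) :=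
  Submodule.span ℂ {φ | ∃ M : Q → Matrix (ZMod 2) (ZMod 2) ℂ, ∃ ψ ∈ W,
    (Finset.univ.filter fun q => M q ≠ 1).card ≤ t ∧ φ = tensorOp M ψ}

/-- `∑_{t ≥ 1} t (Π_t - Π_{t-1})`, with `Π_t` the orthogonal projection onto the `t`-fattening. The
fattenings are constant from `t = |Q|` on, so that the later terms vanish. -/
def distOp (W : Submodule ℂ (QubitSpace Q)) : QubitSpace Q →L[ℂ] QubitSpace Q :=
  ∑ t ∈ Finset.Icc 1 (Fintype.card Q),
    (t : ℂ) • ((fattening W t).starProjection - (fattening W (t - 1)).starProjection)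

/-- The stabiliser code with generators `S i` has soundness `ρ`:
`(1/m) ∑ i, (1 - S i)/2 ⪰ (ρ/n) D` for the operator `D` above. -/
def HasQuantumSoundness [Fintype K] (S : K → (QubitSpace Q →L[ℂ] QubitSpace Q)) (ρ : ℝ) : Prop :=
  ((Fintype.card K : ℂ)⁻¹ • ∑ i, (1 / 2 : ℂ) • (1 - S i)
    - ((ρ / Fintype.card Q : ℝ) : ℂ) • distOp (codeSpace S)).IsPositive

end Operators

namespace CSSCode

variable {Q X Z : Type*} [Fintype Q] [DecidableEq Q] [Fintype X] [Fintype Z]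

/-- The stabiliser generators of a CSS code. -/
def generators (C : CSSCode Q X Z) : X ⊕ Z → (QubitSpace Q →L[ℂ] QubitSpace Q) :=
  Sum.elim (fun i => pauliX (C.HX i)) (fun i => pauliZ (C.HZ i))

/-- The CSS code is quantum locally testable with locality `ω` and soundness `ρ`. -/
def IsLocallyTestable (C : CSSCode Q X Z) (ω : ℕ) (ρ : ℝ) : Prop :=
  (∀ i, hammingNorm (C.HX i) ≤ ω) ∧ (∀ i, hammingNorm (C.HZ i) ≤ ω) ∧
    HasQuantumSoundness C.generators ρ

end CSSCode

/-! ### Subcodes -/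

/-- The matrix over `𝔽₂` of the linear map that sends each basis vector `a` to `f a`. -/
def basisMatrix {α β : Type*} [DecidableEq β] (f : α → β) : Matrix β α (ZMod 2) :=
  Matrix.of fun b a => if f a = b then 1 else 0

/-- An injective, basis-preserving chain map from `A` to `C`, which makes `A` a subcode of `C`. -/
structure SubcodeMap {QA XA ZA Q X Z : Type*} [Fintype QA] [Fintype XA]
    [Fintype Q] [Fintype Z] [DecidableEq Q] [DecidableEq X] [DecidableEq Z]
    (A : CSSCode QA XA ZA) (C : CSSCode Q X Z) where
  qubit : QA ↪ Q
  xCheck : XA ↪ X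
  zCheck : ZA ↪ Z
  comm_one : basisMatrix xCheck * A.HX = C.HX * basisMatrix qubit
  comm_two : basisMatrix qubit * A.HZᵀ = C.HZᵀ * basisMatrix zCheck

/-! ### Hypergraphs, thickening, cycle bases -/

/-- The hypergraph of a code, through its edge-vertex incidence matrix `𝔽₂^E → 𝔽₂^V`: the vertices
are the qubits, the hyperedges are the `X`-checks. -/
def CSSCode.incidence {Q X Z : Type*} [Fintype Q] (A : CSSCode Q X Z) : Matrix Q X (ZMod 2) :=
  A.HXᵀ

/-- The incidence matrix of the path graph with `L` vertices and `L - 1` edges. -/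
def pathIncidence (L : ℕ) : Matrix (Fin L) (Fin (L - 1)) (ZMod 2) :=
  Matrix.of fun l k => if (l : ℕ) = k ∨ (l : ℕ) = k + 1 then 1 else 0

/-- The incidence matrix of a hypergraph thickened `L` times, that is, of its Cartesian product with
the path graph on `L` vertices. -/
def thicken {V E : Type*} [DecidableEq V] (G : Matrix V E (ZMod 2)) (L : ℕ) :
    Matrix (V × Fin L) (E × Fin L ⊕ V × Fin (L - 1)) (ZMod 2) :=
  Matrix.fromCols (G ⊗ₖ (1 : Matrix (Fin L) (Fin L) (ZMod 2)))
    ((1 : Matrix V V (ZMod 2)) ⊗ₖ pathIncidence L)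

/-- `N : 𝔽₂^F → 𝔽₂^E` is a cycle basis of the hypergraph with incidence matrix `G`. -/
def IsCycleBasis {V E F : Type*} [Fintype E] [Fintype F] (G : Matrix V E (ZMod 2))
    (N : Matrix E F (ZMod 2)) : Prop :=
  Function.Injective N.mulVec ∧ LinearMap.range N.mulVecLin = LinearMap.ker G.mulVecLin

theorem IsCycleBasis.mul_eq_zero {V E F : Type*} [Fintype E] [Fintype F]
    {G : Matrix V E (ZMod 2)} {N : Matrix E F (ZMod 2)} (h : IsCycleBasis G N) : G * N = 0 := by
  classical
  ext i j
  have h1 : N.mulVecLin (Pi.single j 1) ∈ LinearMap.ker G.mulVecLin := by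
    rw [← h.2]; exact LinearMap.mem_range_self _ _
  have h2 := congrFun (LinearMap.mem_ker.1 h1) i
  simp only [Matrix.mulVecLin_apply, Matrix.mulVec_single_one] at h2
  exact h2

/-! ### Partial block reading with a thickened hypergraph -/

section Deformed

variable {QA XA ZA : Type*} [Fintype QA] [Fintype XA] [DecidableEq QA]
  {A : CSSCode QA XA ZA}
  {ι : Type*} [Fintype ι] [DecidableEq ι] {Q X Z : ι → Type*}
  [∀ j, Fintype (Q j)] [∀ j, Fintype (Z j)]
  [∀ j, DecidableEq (Q j)] [∀ j, DecidableEq (X j)] [∀ j, DecidableEq (Z j)]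
  {C : ∀ j, CSSCode (Q j) (X j) (Z j)} {L : ℕ}

/-- The component of the chain map `∑ j, f j` from the vertices of the thickened hypergraph to the
qubits of the blocks; block `j` is attached at level `lev j`. -/
def attachQubit (f : ∀ j, SubcodeMap A (C j)) (lev : ι → Fin L) :
    Matrix (Σ j, Q j) (QA × Fin L) (ZMod 2) :=
  Matrix.of fun p a => if a.2 = lev p.1 then basisMatrix (f p.1).qubit p.2 a.1 else 0

/-- The component of the chain map `∑ j, f j` from the hyperedges of the thickened hypergraph to
the `X`-checks of the blocks. -/
def attachXCheck (f : ∀ j, SubcodeMap A (C j)) (lev : ι → Fin L) :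
    Matrix (Σ j, X j) (XA × Fin L ⊕ QA × Fin (L - 1)) (ZMod 2) :=
  Matrix.fromCols
    (Matrix.of fun p b => if b.2 = lev p.1 then basisMatrix (f p.1).xCheck p.2 b.1 else 0) 0

theorem attach_comm (f : ∀ j, SubcodeMap A (C j)) (lev : ι → Fin L) :
    Matrix.blockDiagonal' (fun j => (C j).HX) * attachQubit f lev
      = attachXCheck f lev * (thicken A.incidence L)ᵀ := by
  ext ⟨j, x⟩ ⟨a, l⟩
  have key := congrFun (congrFun (f j).comm_one x) a
  simp only [Matrix.mul_apply] at key
  simp only [Matrix.mul_apply, attachQubit, attachXCheck, thicken, Matrix.transpose_apply,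
    Fintype.sum_sum_type, Matrix.fromCols_apply_inl, Matrix.fromCols_apply_inr, Matrix.zero_apply,
    zero_mul, Finset.sum_const_zero, add_zero, Matrix.of_apply, Fintype.sum_sigma,
    Fintype.sum_prod_type, Matrix.kroneckerMap_apply, CSSCode.incidence, Matrix.one_apply]
  rw [Finset.sum_eq_single j]
  · by_cases hl : l = lev j
    · subst hl
      simpa [Matrix.blockDiagonal'_apply_eq] using key.symm
    · simp [hl]
  · intro k _ hk
    simp [Matrix.blockDiagonal'_apply_ne _ _ _ (Ne.symm hk)]
  · simp

/-- The deformed code of the partial block reading of `Z` type given by the subcode maps `f j`, with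
the hypergraph of `A` thickened `L` times, block `j` attached at level `lev j`, and all cycles
gauge-fixed by the cycle basis `N`.

It is the mapping cone of the chain map `∑ j, f j` from the (degree-shifted) thickened hypergraph to
the sum of the blocks, together with the cycle checks: new qubits are the hyperedges, new `Z`-checks
the vertices, new `X`-checks the cycles in the basis. -/
def deformedCode (f : ∀ j, SubcodeMap A (C j)) (lev : ι → Fin L) {F : Type*} [Fintype F]
    (N : Matrix (XA × Fin L ⊕ QA × Fin (L - 1)) F (ZMod 2))
    (hN : IsCycleBasis (thicken A.incidence L) N) :
    CSSCode ((Σ j, Q j) ⊕ (XA × Fin L ⊕ QA × Fin (L - 1)))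
      ((Σ j, X j) ⊕ F) ((Σ j, Z j) ⊕ QA × Fin L) where
  HX := Matrix.fromBlocks (Matrix.blockDiagonal' fun j => (C j).HX) (attachXCheck f lev) 0 Nᵀ
  HZ := Matrix.fromBlocks (Matrix.blockDiagonal' fun j => (C j).HZ) 0
    (attachQubit f lev)ᵀ (thicken A.incidence L)
  comm := by
    have h1 : (Matrix.blockDiagonal' fun j => (C j).HX)
        * (Matrix.blockDiagonal' fun j => (C j).HZ)ᵀ = 0 := by
      rw [Matrix.blockDiagonal'_transpose, ← Matrix.blockDiagonal'_mul]
      simp only [(C _).comm]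
      exact Matrix.blockDiagonal'_zero
    have h2 : Nᵀ * (thicken A.incidence L)ᵀ = 0 := by
      rw [← Matrix.transpose_mul, hN.mul_eq_zero, Matrix.transpose_zero]
    rw [Matrix.fromBlocks_transpose, Matrix.fromBlocks_multiply, Matrix.transpose_transpose,
      attach_comm, h1, h2]
    have h3 : ∀ M : Matrix (Σ j, X j) (QA × Fin L) (ZMod 2), M + M = 0 := fun M => by
      ext i k; exact CharTwo.add_self_eq_zero _
    simp [h3]

end Deformed

end

/-! Quantum soundness is used only through a classical consequence. An error `Z(w)` applied to a
code state violates exactly the `X`-checks in the syndrome `HX w`, and the result is orthogonal to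
every `t`-fattening with `t` below the weight of the lightest error of that syndrome. Its energy
therefore gives `κ * dist(w, ker HX) ≤ |HX w|` with `κ = ρ m / n`, and symmetrically for `HZ`
(`IsPauliPair.classical_soundness`).

Distance: an `X` logical of the deformed code is already nontrivial on some block, because all
cycles are checks. A `Z` logical `(u, e)` has `e` orthogonal to all cycles, so `e` is a coboundary
of some `w`, and vertex checks clear it at the price of adding one level of `w` to each block.
Averaging over at least `1 / κ` levels yields a `w` none of whose levels is heavier than `e`
(`exists_thicken_transpose_mulVec_level_le`). Some block part of the cleared operator is nontrivial,
and it weighs at most `|u| + |e|`.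

Cost: sparsity and coverage give `n ≤ σ m`, so everything added is `O(m L)`, and `m L ≤ 2 n / ρ +
m`. A single-qubit error violates at most `σ` checks of one type, whence `κ ≤ σ`, that is, `m ≤ σ n
/ ρ`. -/

/-! ### Linear algebra over a field -/

/-- A vector orthogonal to the kernel of a matrix lies in its row space. -/
theorem Matrix.exists_transpose_mulVec_eq {m n K : Type*} [Fintype m] [Fintype n] [Field K]
    (M : Matrix m n K) (e : n → K) (he : ∀ z, M *ᵥ z = 0 → e ⬝ᵥ z = 0) :
    ∃ w : m → K, Mᵀ *ᵥ w = e := by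
  classical
  have hmem : dotProductEquiv K n e ∈ (LinearMap.ker M.mulVecLin).dualAnnihilator := by
    rw [Submodule.mem_dualAnnihilator]
    intro z hz
    exact he z hz
  rw [← LinearMap.range_dualMap_eq_dualAnnihilator_ker] at hmem
  obtain ⟨g, hg⟩ := hmem
  refine ⟨(dotProductEquiv K m).symm g, (dotProductEquiv K n).injective ?_⟩
  rw [← hg]
  refine LinearMap.ext fun z => ?_
  have h : g (M *ᵥ z) = (dotProductEquiv K m).symm g ⬝ᵥ M *ᵥ z := by
    conv_lhs => rw [← (dotProductEquiv K m).apply_symm_apply g]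
    rfl
  change (Mᵀ *ᵥ (dotProductEquiv K m).symm g) ⬝ᵥ z = g (M *ᵥ z)
  rw [h, Matrix.mulVec_transpose, Matrix.dotProduct_mulVec]

/-- If no vector of `w + ker M` is supported in `T`, a row-space vector vanishing on `T` detects
`w`. -/
theorem Matrix.exists_transpose_mulVec_detecting {m n K : Type*} [Fintype m] [Fintype n] [Field K]
    (M : Matrix m n K) (w : n → K) (T : Set n)
    (hw : ∀ z, M *ᵥ z = 0 → ∃ q ∉ T, (w + z) q ≠ 0) :
    ∃ g : m → K, (∀ q ∈ T, (Mᵀ *ᵥ g) q = 0) ∧ (Mᵀ *ᵥ g) ⬝ᵥ w ≠ 0 := by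
  classical
  let U : Submodule K (n → K) :=
    { carrier := {x | ∀ q ∉ T, x q = 0}
      zero_mem' := fun _ _ => rfl
      add_mem' := fun hx hy q hq => by rw [Pi.add_apply, hx q hq, hy q hq, add_zero]
      smul_mem' := fun c x hx q hq => by rw [Pi.smul_apply, hx q hq, smul_zero] }
  have hU : ∀ x, x ∈ U ↔ ∀ q ∉ T, x q = 0 := fun x => Iff.rfl
  have hnot : w ∉ LinearMap.ker M.mulVecLin ⊔ U := by
    rw [Submodule.mem_sup]
    rintro ⟨z, hz, x, hx, rfl⟩
    obtain ⟨q, hq, hne⟩ := hw (-z) (by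
      rw [Matrix.mulVec_neg, neg_eq_zero]; exact hz)
    exact hne (by simpa using (hU x).1 hx q hq)
  -- Separate `w` from `ker M + U`: vanishing on `ker M` puts the functional in the row space, and
  -- vanishing on `U`, the vectors supported in `T`, makes it zero on `T`.
  obtain ⟨f, hf, hle⟩ := Submodule.exists_le_ker_of_notMem hnot
  have hfe : ∀ x, f x = (dotProductEquiv K n).symm f ⬝ᵥ x := fun x => by
    conv_lhs => rw [← (dotProductEquiv K n).apply_symm_apply f]
    rfl
  obtain ⟨g, hg⟩ := M.exists_transpose_mulVec_eq ((dotProductEquiv K n).symm f) fun z hz => by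
    rw [← hfe]
    exact hle (Submodule.mem_sup_left hz)
  refine ⟨g, fun q hq => ?_, ?_⟩
  · have : f (Pi.single q 1) = 0 := hle (Submodule.mem_sup_right ((hU _).2 fun p hp => by
      rw [Pi.single_eq_of_ne]; rintro rfl; exact hp hq))
    rwa [hfe, dotProduct_single_one, ← hg] at this
  · rw [hg, ← hfe]
    exact hf

/-! ### Pauli operators in coordinates -/

theorem ZMod.two_eq_zero_or_one : ∀ a : ZMod 2, a = 0 ∨ a = 1 := by decide

/-- The nontrivial additive character of `𝔽₂`. -/
def signChar (a : ZMod 2) : ℂ := if a = 0 then 1 else -1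

theorem signChar_zero : signChar 0 = 1 := by simp [signChar]

theorem signChar_of_ne_zero {a : ZMod 2} (h : a ≠ 0) : signChar a = -1 := by simp [signChar, h]

theorem signChar_add (a b : ZMod 2) : signChar (a + b) = signChar a * signChar b := by
  rcases a.two_eq_zero_or_one with rfl | rfl <;> rcases b.two_eq_zero_or_one with rfl | rfl <;>
    simp [signChar, CharTwo.add_self_eq_zero]

theorem signChar_mul_self (a : ZMod 2) : signChar a * signChar a = 1 := by
  rw [← signChar_add, CharTwo.add_self_eq_zero, signChar_zero]

theorem star_signChar (a : ZMod 2) : star (signChar a) = signChar a := by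
  unfold signChar; split_ifs <;> simp

theorem signChar_sum {ι : Type*} (s : Finset ι) (f : ι → ZMod 2) :
    signChar (∑ i ∈ s, f i) = ∏ i ∈ s, signChar (f i) := by
  classical
  induction s using Finset.induction_on with
  | empty => simp [signChar_zero]
  | insert a s ha ih => rw [Finset.sum_insert ha, Finset.prod_insert ha, signChar_add, ih]

section Pauli

variable {Q : Type*} [Fintype Q] [DecidableEq Q]

theorem tensorOp_apply (M : Q → Matrix (ZMod 2) (ZMod 2) ℂ) (φ : QubitSpace Q) (x : Q → ZMod 2) :
    tensorOp M φ x = ∑ y, (∏ q, M q (x q) (y q)) * φ y := by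
  rw [tensorOp, Matrix.ofLp_toEuclideanCLM]
  rfl

theorem tensorOp_mul (M M' : Q → Matrix (ZMod 2) (ZMod 2) ℂ) :
    tensorOp M * tensorOp M' = tensorOp fun q => M q * M' q := by
  rw [tensorOp, tensorOp, ← map_mul, tensorOp]
  congr 1
  ext x y
  simp only [Matrix.mul_apply, Matrix.of_apply, ← Finset.prod_mul_distrib]
  rw [Finset.prod_univ_sum, Fintype.piFinset_univ]

theorem tensorOp_commute {M M' : Q → Matrix (ZMod 2) (ZMod 2) ℂ} (h : ∀ q, M q = 1 ∨ M' q = 1) :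
    Commute (tensorOp M) (tensorOp M') := by
  rw [commute_iff_eq, tensorOp_mul, tensorOp_mul]
  congr 1
  funext q
  rcases h q with h | h <;> simp [h]

theorem pauliX_apply (u : Q → ZMod 2) (φ : QubitSpace Q) (x : Q → ZMod 2) :
    pauliX u φ x = φ (x + u) := by
  have h : ∀ a b c : ZMod 2, (if a = 0 then (1 : Matrix (ZMod 2) (ZMod 2) ℂ) else pauliMatX) b c
      = if c = b + a then 1 else 0 := by
    intro a b c
    rcases a.two_eq_zero_or_one with rfl | rfl <;> rcases b.two_eq_zero_or_one with rfl | rfl <;>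
      rcases c.two_eq_zero_or_one with rfl | rfl <;>
      simp [pauliMatX, CharTwo.add_self_eq_zero]
  rw [pauliX, tensorOp_apply, Finset.sum_eq_single (x + u)]
  · simp [h]
  · intro y _ hy
    obtain ⟨q, hq⟩ := Function.ne_iff.1 hy
    rw [Finset.prod_eq_zero (Finset.mem_univ q), zero_mul]
    rw [h]
    exact if_neg hq
  · simp

theorem pauliZ_apply (v : Q → ZMod 2) (φ : QubitSpace Q) (x : Q → ZMod 2) :
    pauliZ v φ x = signChar (v ⬝ᵥ x) * φ x := by
  have h : ∀ a b c : ZMod 2, (if a = 0 then (1 : Matrix (ZMod 2) (ZMod 2) ℂ) else pauliMatZ) b c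
      = if c = b then signChar (a * b) else 0 := by
    intro a b c
    rcases a.two_eq_zero_or_one with rfl | rfl <;> rcases b.two_eq_zero_or_one with rfl | rfl <;>
      rcases c.two_eq_zero_or_one with rfl | rfl <;>
      simp [pauliMatZ, signChar]
  rw [pauliZ, tensorOp_apply, Finset.sum_eq_single x]
  · simp [h, dotProduct, signChar_sum]
  · intro y _ hy
    obtain ⟨q, hq⟩ := Function.ne_iff.1 hy
    rw [Finset.prod_eq_zero (Finset.mem_univ q), zero_mul]
    rw [h, if_neg hq]
  · simp

theorem pauliX_zero : pauliX (0 : Q → ZMod 2) = 1 := by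
  ext φ x; simp [pauliX_apply]

theorem pauliZ_zero : pauliZ (0 : Q → ZMod 2) = 1 := by
  ext φ x; simp [pauliZ_apply, signChar_zero]

theorem pauliX_add (u v : Q → ZMod 2) : pauliX (u + v) = pauliX u * pauliX v := by
  ext φ x; simp [pauliX_apply, add_assoc]

theorem pauliZ_add (u v : Q → ZMod 2) : pauliZ (u + v) = pauliZ u * pauliZ v := by
  ext φ x; simp [pauliZ_apply, signChar_add, mul_assoc]

theorem pauliX_pauliZ (u v : Q → ZMod 2) (φ : QubitSpace Q) :
    pauliX u (pauliZ v φ) = signChar (v ⬝ᵥ u) • pauliZ v (pauliX u φ) := by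
  ext x
  simp [pauliX_apply, pauliZ_apply, signChar_add, dotProduct_add]
  ring

theorem pauliZ_pauliX (u v : Q → ZMod 2) (φ : QubitSpace Q) :
    pauliZ v (pauliX u φ) = signChar (v ⬝ᵥ u) • pauliX u (pauliZ v φ) := by
  rw [pauliX_pauliZ, smul_smul, signChar_mul_self, one_smul]

theorem inner_pauliX (u : Q → ZMod 2) (φ ψ : QubitSpace Q) :
    inner ℂ (pauliX u φ) (pauliX u ψ) = inner ℂ φ ψ := by
  simp only [PiLp.inner_apply, pauliX_apply]
  exact Equiv.sum_comp (Equiv.addRight u) fun x => inner ℂ (φ x) (ψ x)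

theorem inner_pauliZ (v : Q → ZMod 2) (φ ψ : QubitSpace Q) :
    inner ℂ (pauliZ v φ) (pauliZ v ψ) = inner ℂ φ ψ := by
  simp only [PiLp.inner_apply, pauliZ_apply]
  refine Finset.sum_congr rfl fun x _ => ?_
  have h := star_signChar (v ⬝ᵥ x)
  have h2 := signChar_mul_self (v ⬝ᵥ x)
  simp only [RCLike.inner_apply, map_mul]
  rw [starRingEnd_apply, h]
  linear_combination (ψ x * (starRingEnd ℂ) (φ x)) * h2

/-! ### The operator form of soundness -/

variable {K : Type*}

omit [DecidableEq Q] in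
theorem mem_codeSpace {S : K → (QubitSpace Q →L[ℂ] QubitSpace Q)} {ψ : QubitSpace Q} :
    ψ ∈ codeSpace S ↔ ∀ i, S i ψ = ψ := by
  simp [codeSpace, LinearMap.mem_eqLocus]

theorem fattening_mono (W : Submodule ℂ (QubitSpace Q)) : Monotone (fattening W) := by
  intro s t hst
  refine Submodule.span_mono ?_
  rintro φ ⟨M, ψ, hψ, hM, rfl⟩
  exact ⟨M, ψ, hψ, hM.trans hst, rfl⟩

/-- Places error states in the largest fattening, where the telescoping sum of `distOp` recovers
their full norm. -/
theorem tensorOp_mem_fattening (W : Submodule ℂ (QubitSpace Q))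
    (M : Q → Matrix (ZMod 2) (ZMod 2) ℂ) {ψ : QubitSpace Q} (hψ : ψ ∈ W) :
    tensorOp M ψ ∈ fattening W (Fintype.card Q) :=
  Submodule.subset_span ⟨M, ψ, hψ, Finset.card_le_univ _, rfl⟩

/-- A state orthogonal to all `t`-fattenings with `t < δ` has energy at least `δ` for `distOp`. -/
theorem le_inner_distOp (W : Submodule ℂ (QubitSpace Q)) (φ : QubitSpace Q)
    (hφ : φ ∈ fattening W (Fintype.card Q)) (δ : ℕ)
    (horth : ∀ t < δ, φ ∈ (fattening W t)ᗮ) :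
    δ * ‖φ‖ ^ 2 ≤ (inner ℂ φ (distOp W φ)).re := by
  let a : ℕ → ℝ := fun t => ‖(fattening W t).starProjection φ‖ ^ 2
  have hsum : (inner ℂ φ (distOp W φ)).re
      = ∑ t ∈ Finset.Icc 1 (Fintype.card Q), (t : ℝ) * (a t - a (t - 1)) := by
    have ha : ∀ t, (inner ℂ φ ((fattening W t).starProjection φ)).re = a t := fun t => by
      have := (fattening W t).re_inner_starProjection_eq_normSq φ
      rw [Submodule.inner_starProjection_left_eq_right] at this
      exact this
    simp only [distOp, _root_.sum_apply, inner_sum, Complex.re_sum,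
      _root_.smul_apply, _root_.sub_apply, inner_smul_right, inner_sub_right]
    refine Finset.sum_congr rfl fun t _ => ?_
    rw [← Complex.ofReal_natCast, Complex.re_ofReal_mul, Complex.sub_re, ha, ha]
  have hmono : Monotone a := by
    intro s t hst
    have h := Submodule.starProjection_comp_starProjection_of_le (fattening_mono W hst)
    have h2 := congrArg (fun T => T φ) h
    simp only [ContinuousLinearMap.comp_apply] at h2
    have h3 := (fattening W s).norm_starProjection_apply_le ((fattening W t).starProjection φ)
    rw [h2] at h3
    exact pow_le_pow_left₀ (norm_nonneg _) h3 2
  have hzero : ∀ t < δ, a t = 0 := fun t ht => by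
    simp [a, (Submodule.starProjection_apply_eq_zero_iff _).2 (horth t ht)]
  have hlast : a (Fintype.card Q) = ‖φ‖ ^ 2 := by
    simp only [a, Submodule.starProjection_eq_self_iff.2 hφ]
  have htel : ∀ n, ∑ t ∈ Finset.Icc 1 n, (a t - a (t - 1)) = a n - a 0 := by
    intro n
    induction n with
    | zero => simp
    | succ n ih => rw [Finset.sum_Icc_succ_top (by omega), ih, Nat.add_sub_cancel]; ring
  -- The increments of `a` are nonnegative and vanish for `t < δ`, so replacing the factor `t` by
  -- `δ` only lowers the sum, which then telescopes.
  have hstep : ∀ t ∈ Finset.Icc 1 (Fintype.card Q),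
      (δ : ℝ) * (a t - a (t - 1)) ≤ (t : ℝ) * (a t - a (t - 1)) := by
    intro t _
    rcases lt_or_ge t δ with ht | ht
    · rw [hzero t ht, hzero (t - 1) (by omega)]; simp
    · exact mul_le_mul_of_nonneg_right (by exact_mod_cast ht)
        (sub_nonneg.2 (hmono (Nat.sub_le t 1)))
  rw [hsum]
  refine le_trans ?_ (Finset.sum_le_sum hstep)
  rw [← Finset.mul_sum, htel, hlast]
  rcases Nat.eq_zero_or_pos δ with rfl | hδ
  · simp
  · rw [hzero 0 hδ, sub_zero]

/-- Soundness bounds the fraction of violated generators of a syndrome eigenstate from below by its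
distance from the code space. -/
theorem HasQuantumSoundness.le_card_violated [Fintype K]
    {S : K → (QubitSpace Q →L[ℂ] QubitSpace Q)} {ρ : ℝ} (hS : HasQuantumSoundness S ρ)
    (hρ : 0 ≤ ρ) {φ : QubitSpace Q} (hne : φ ≠ 0)
    (hφ : φ ∈ fattening (codeSpace S) (Fintype.card Q)) (s : Finset K)
    (hs : ∀ i ∈ s, S i φ = -φ) (hs' : ∀ i ∉ s, S i φ = φ) {δ : ℕ}
    (horth : ∀ t < δ, φ ∈ (fattening (codeSpace S) t)ᗮ) :
    ρ / Fintype.card Q * δ ≤ s.card / Fintype.card K := by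
  classical
  have hpos := hS.re_inner_nonneg_right φ
  have henergy : ∑ i, (1 / 2 : ℂ) • (φ - S i φ) = (s.card : ℂ) • φ := by
    have : ∀ i, (1 / 2 : ℂ) • (φ - S i φ) = if i ∈ s then φ else 0 := by
      intro i
      split_ifs with hi
      · rw [hs i hi, sub_neg_eq_add, ← two_smul ℂ φ, smul_smul]; norm_num
      · rw [hs' i hi, sub_self, smul_zero]
    rw [Finset.sum_congr rfl fun i _ => this i, Finset.sum_ite_mem, Finset.univ_inter,
      Finset.sum_const, Nat.cast_smul_eq_nsmul]
  simp only [_root_.sub_apply, _root_.smul_apply,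
    _root_.sum_apply, one_apply_eq_self, henergy, inner_sub_right,
    inner_smul_right, map_sub, RCLike.re_to_complex, inner_self_eq_norm_sq_to_K] at hpos
  have hD := le_inner_distOp _ φ hφ δ horth
  have hcoef : 0 ≤ ρ / Fintype.card Q := by positivity
  have hnorm : 0 < ‖φ‖ ^ 2 := by positivity
  have e1 : ((Fintype.card K : ℂ)⁻¹ * ((s.card : ℂ) * ((‖φ‖ : ℂ)) ^ 2)).re
      = s.card / Fintype.card K * ‖φ‖ ^ 2 := by
    rw [show ((Fintype.card K : ℂ)⁻¹ * ((s.card : ℂ) * ((‖φ‖ : ℂ)) ^ 2))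
      = ((s.card / Fintype.card K * ‖φ‖ ^ 2 : ℝ) : ℂ) by push_cast; ring, Complex.ofReal_re]
  rw [Complex.re_ofReal_mul] at hpos
  have h1 := mul_le_mul_of_nonneg_left hD hcoef
  have h2 : ρ / Fintype.card Q * δ * ‖φ‖ ^ 2 ≤ s.card / Fintype.card K * ‖φ‖ ^ 2 := by
    rw [← e1, mul_assoc]
    exact h1.trans (sub_nonneg.1 hpos)
  exact le_of_mul_le_mul_right h2 hnorm

/-! ### From quantum to classical soundness -/

/-- `P` and `E` are the two families of Pauli operators `u ↦ X(u)` and `v ↦ Z(v)`, in either order: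
local commuting unitaries that commute with each other up to the sign given by the dot product. -/
structure IsPauliPair (P E : (Q → ZMod 2) → (QubitSpace Q →L[ℂ] QubitSpace Q)) : Prop where
  zero : P 0 = 1
  add : ∀ u v, P (u + v) = P u * P v
  inner_left : ∀ u α β, inner ℂ (P u α) (P u β) = inner ℂ α β
  inner_right : ∀ v α β, inner ℂ (E v α) (E v β) = inner ℂ α β
  comm : ∀ u v α, P u (E v α) = signChar (u ⬝ᵥ v) • E v (P u α)
  commute_tensorOp : ∀ u M, (∀ q, M q = 1 ∨ u q = 0) → Commute (P u) (tensorOp M)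
  exists_tensorOp : ∀ v, ∃ M, E v = tensorOp M

theorem isPauliPair_XZ : IsPauliPair (Q := Q) pauliX pauliZ where
  zero := pauliX_zero
  add := pauliX_add
  inner_left := inner_pauliX
  inner_right := inner_pauliZ
  comm u v α := by rw [pauliX_pauliZ, dotProduct_comm]
  commute_tensorOp _ _ h := tensorOp_commute fun q => (h q).symm.imp_left fun h => if_pos h
  exists_tensorOp _ := ⟨_, rfl⟩

theorem isPauliPair_ZX : IsPauliPair (Q := Q) pauliZ pauliX where
  zero := pauliZ_zero
  add := pauliZ_add
  inner_left := inner_pauliZ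
  inner_right := inner_pauliX
  comm u v α := pauliZ_pauliX v u α
  commute_tensorOp _ _ h := tensorOp_commute fun q => (h q).symm.imp_left fun h => if_pos h
  exists_tensorOp _ := ⟨_, rfl⟩

namespace IsPauliPair

variable {P E : (Q → ZMod 2) → (QubitSpace Q →L[ℂ] QubitSpace Q)} {I : Type*} [Fintype I]
  {H : Matrix I Q (ZMod 2)}

theorem stabilises (hPE : IsPauliPair P E) {ψ : QubitSpace Q} (hψ : ∀ i, P (H i) ψ = ψ)
    (g : I → ZMod 2) : P (Hᵀ *ᵥ g) ψ = ψ := by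
  rw [Matrix.mulVec_transpose, Matrix.vecMul_eq_sum]
  refine Finset.sum_induction _ (fun u => P u ψ = ψ) ?_ ?_ ?_
  · intro u v hu hv
    rw [hPE.add, mul_apply_eq_comp, hv, hu]
  · rw [hPE.zero, one_apply_eq_self]
  · intro i _
    rcases (g i).two_eq_zero_or_one with h | h
    · rw [h, zero_smul, hPE.zero, one_apply_eq_self]
    · rw [h, one_smul]
      exact hψ i

/-- An error `E w` takes the code to the orthogonal complement of its `t`-fattening, if no error
with the same syndrome has weight at most `t`. -/
theorem mem_fattening_orthogonal (hPE : IsPauliPair P E) {W : Submodule ℂ (QubitSpace Q)}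
    (hW : ∀ ψ ∈ W, ∀ i, P (H i) ψ = ψ) {w : Q → ZMod 2} {t : ℕ}
    (hw : ∀ z, H *ᵥ z = 0 → t < hammingNorm (w + z)) {ψ : QubitSpace Q} (hψ : ψ ∈ W) :
    E w ψ ∈ (fattening W t)ᗮ := by
  classical
  rw [fattening, Submodule.mem_orthogonal]
  intro x hx
  rw [← Submodule.mem_orthogonal_singleton_iff_inner_left]
  refine Submodule.span_le.2 ?_ hx
  rintro _ ⟨M, ψ', hψ', hM, rfl⟩
  rw [SetLike.mem_coe, Submodule.mem_orthogonal_singleton_iff_inner_left]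
  -- The stabiliser `P (Hᵀ g)` avoids the qubits touched by `M` and anticommutes with `E w`. It
  -- fixes `tensorOp M ψ'` and negates `E w ψ`, and being unitary it forces their inner product to
  -- vanish.
  obtain ⟨g, hg, hgw⟩ := H.exists_transpose_mulVec_detecting w {q | M q ≠ 1} (by
    intro z hz
    by_contra! hcon
    refine absurd (hw z hz) (not_lt.2 (le_trans (Finset.card_le_card fun q hq => ?_) hM))
    simp only [Finset.mem_filter, Finset.mem_univ, true_and] at hq ⊢
    intro h1
    exact hq (hcon q (by simpa using h1)))
  have h1 : P (Hᵀ *ᵥ g) (tensorOp M ψ') = tensorOp M ψ' := by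
    have hT := hPE.commute_tensorOp (Hᵀ *ᵥ g) M fun q => (em (M q = 1)).imp_right (hg q)
    rw [← mul_apply_eq_comp, hT.eq, mul_apply_eq_comp, hPE.stabilises (hW ψ' hψ')]
  have h := hPE.inner_left (Hᵀ *ᵥ g) (tensorOp M ψ') (E w ψ)
  rw [h1, hPE.comm, signChar_of_ne_zero hgw, hPE.stabilises (hW ψ hψ), neg_one_smul,
    inner_neg_right] at h
  exact self_eq_neg.1 h.symm

/-- If a stabiliser code has generators `P (H i)` and others that commute with all errors `E w`,
quantum soundness of the code implies classical soundness of the parity-check matrix `H`. -/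
theorem classical_soundness (hPE : IsPauliPair P E) [Fintype K]
    {S : K → (QubitSpace Q →L[ℂ] QubitSpace Q)} {ρ : ℝ} (hS : HasQuantumSoundness S ρ)
    (hρ : 0 ≤ ρ) (hne : ∃ ψ ∈ codeSpace S, ψ ≠ 0) (e : I ↪ K) (hSe : ∀ i, S (e i) = P (H i))
    (hS' : ∀ k ∉ Set.range e, ∀ w ψ, S k (E w ψ) = E w (S k ψ)) (w : Q → ZMod 2) :
    ∃ z, H *ᵥ z = 0 ∧ ρ / Fintype.card Q * hammingNorm (w + z)
      ≤ hammingNorm (H *ᵥ w) / Fintype.card K := by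
  classical
  -- `w + z` is a lightest error with the syndrome of `w`; its weight plays the role of `δ`.
  obtain ⟨z, hz, hmin⟩ := Finset.exists_min_image
    (Finset.univ.filter fun z => H *ᵥ z = 0) (fun z => hammingNorm (w + z)) ⟨0, by simp⟩
  simp only [Finset.mem_filter, Finset.mem_univ, true_and] at hz hmin
  refine ⟨z, hz, ?_⟩
  obtain ⟨ψ, hψ, hne⟩ := hne
  have hW : ∀ ψ ∈ codeSpace S, ∀ i, P (H i) ψ = ψ := fun ψ hψ i => by
    rw [← hSe, mem_codeSpace.1 hψ]
  have hsyn : ∀ i, S (e i) (E w ψ) = signChar ((H *ᵥ w) i) • E w ψ := fun i => by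
    rw [hSe, hPE.comm, hW ψ hψ]
    rfl
  have h := hS.le_card_violated hρ (φ := E w ψ) (δ := hammingNorm (w + z)) ?_ ?_
    ((Finset.univ.filter fun i => (H *ᵥ w) i ≠ 0).map e) ?_ ?_ ?_
  · rwa [Finset.card_map] at h
  · intro h0
    have := hPE.inner_right w ψ ψ
    rw [h0, inner_zero_left] at this
    exact hne (inner_self_eq_zero.1 this.symm)
  · obtain ⟨M, hM⟩ := hPE.exists_tensorOp w
    rw [hM]
    exact tensorOp_mem_fattening _ _ hψ
  · intro k hk
    obtain ⟨i, hi, rfl⟩ := Finset.mem_map.1 hk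
    rw [hsyn, signChar_of_ne_zero (Finset.mem_filter.1 hi).2, neg_one_smul]
  · intro k hk
    by_cases hke : k ∈ Set.range e
    · obtain ⟨i, rfl⟩ := hke
      have hi : (H *ᵥ w) i = 0 := by
        by_contra hcon
        exact hk (Finset.mem_map_of_mem e (Finset.mem_filter.2 ⟨Finset.mem_univ _, hcon⟩))
      rw [hsyn, hi, signChar_zero, one_smul]
    · rw [hS' k hke, mem_codeSpace.1 hψ]
  · exact fun t ht => hPE.mem_fattening_orthogonal hW (fun z' hz' => ht.trans_le (hmin z' hz')) hψ

end IsPauliPair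

end Pauli

/-! ### Classical soundness of the two check matrices of a locally testable CSS code -/

namespace CSSCode

section Soundness

variable {Q X Z : Type*} [Fintype Q] [DecidableEq Q] [Fintype X] [Fintype Z]

-- The witness is the unnormalised uniform superposition of the row space of `HX`: translation by a
-- row permutes it, and rows of `HZ` are orthogonal to it because the checks commute.
omit [Fintype Z] in
theorem exists_mem_codeSpace_ne_zero (C : CSSCode Q X Z) :
    ∃ ψ ∈ codeSpace C.generators, ψ ≠ 0 := by
  classical
  let R := LinearMap.range C.HXᵀ.mulVecLin
  let ψ : QubitSpace Q := WithLp.toLp 2 fun x => if x ∈ R then 1 else 0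
  have hψ : ∀ x, ψ x = if x ∈ R then 1 else 0 := fun _ => rfl
  refine ⟨ψ, mem_codeSpace.2 ?_, fun h => ?_⟩
  · rintro (i | i)
    · have hi : C.HX i ∈ R := ⟨Pi.single i 1, by ext q; simp⟩
      ext x
      simp [generators, pauliX_apply, hψ, R.add_mem_iff_left hi]
    · ext x
      simp only [generators, Sum.elim_inr, pauliZ_apply, hψ]
      split_ifs with hx
      · obtain ⟨g, rfl⟩ := hx
        have h0 : C.HZ * C.HXᵀ = 0 := by
          rw [← Matrix.transpose_transpose C.HZ, ← Matrix.transpose_mul, C.comm,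
            Matrix.transpose_zero]
        have h1 : C.HZ i ⬝ᵥ C.HXᵀ *ᵥ g = 0 := by
          change (C.HZ *ᵥ (C.HXᵀ *ᵥ g)) i = 0
          rw [Matrix.mulVec_mulVec, h0, Matrix.zero_mulVec, Pi.zero_apply]
        rw [Matrix.mulVecLin_apply, h1, signChar_zero, one_mul]
      · simp
  · have := hψ 0
    rw [h, if_pos R.zero_mem] at this
    simp at this

variable {C : CSSCode Q X Z} {ρ : ℝ}

/-- The `X`-check matrix of a CSS code with soundness `ρ` is classically sound. -/
theorem classical_soundness_HX (hC : HasQuantumSoundness C.generators ρ) (hρ : 0 ≤ ρ)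
    (w : Q → ZMod 2) :
    ∃ z, C.HX *ᵥ z = 0 ∧ ρ / Fintype.card Q * hammingNorm (w + z)
      ≤ hammingNorm (C.HX *ᵥ w) / (Fintype.card X + Fintype.card Z : ℕ) := by
  have h := isPauliPair_XZ.classical_soundness (H := C.HX) hC hρ C.exists_mem_codeSpace_ne_zero
    Function.Embedding.inl (fun i => rfl) ?_ w
  · rwa [Fintype.card_sum] at h
  · rintro (i | i) hi w ψ
    · exact absurd ⟨i, rfl⟩ hi
    · change pauliZ (C.HZ i) _ = pauliZ w (pauliZ (C.HZ i) ψ)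
      rw [← mul_apply_eq_comp, ← mul_apply_eq_comp, ← pauliZ_add, add_comm, pauliZ_add]

/-- The `Z`-check matrix of a CSS code with soundness `ρ` is classically sound. -/
theorem classical_soundness_HZ (hC : HasQuantumSoundness C.generators ρ) (hρ : 0 ≤ ρ)
    (u : Q → ZMod 2) :
    ∃ z, C.HZ *ᵥ z = 0 ∧ ρ / Fintype.card Q * hammingNorm (u + z)
      ≤ hammingNorm (C.HZ *ᵥ u) / (Fintype.card X + Fintype.card Z : ℕ) := by
  have h := isPauliPair_ZX.classical_soundness (H := C.HZ) hC hρ C.exists_mem_codeSpace_ne_zero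
    Function.Embedding.inr (fun i => rfl) ?_ u
  · rwa [Fintype.card_sum] at h
  · rintro (i | i) hi w ψ
    · change pauliX (C.HX i) _ = pauliX w (pauliX (C.HX i) ψ)
      rw [← mul_apply_eq_comp, ← mul_apply_eq_comp, ← pauliX_add, add_comm, pauliX_add]
    · exact absurd ⟨i, rfl⟩ hi

end Soundness

end CSSCode

/-! ### Hamming weights -/

section HammingNorm

variable {α β R : Type*} [Fintype α] [Fintype β] [DecidableEq R]

theorem hammingNorm_eq_sum [Zero R] (v : α → R) :
    hammingNorm v = ∑ a, if v a ≠ 0 then 1 else 0 :=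
  Finset.card_filter _ _

theorem hammingNorm_sum [Zero R] (v : α ⊕ β → R) :
    hammingNorm v = hammingNorm (fun a => v (Sum.inl a)) + hammingNorm fun b => v (Sum.inr b) := by
  simp only [hammingNorm_eq_sum, Fintype.sum_sum_type]

theorem hammingNorm_prod [Zero R] (v : α × β → R) :
    hammingNorm v = ∑ b, hammingNorm fun a => v (a, b) := by
  simp only [hammingNorm_eq_sum, Fintype.sum_prod_type_right]

theorem hammingNorm_le_of_injective [Zero R] {f : α → β} (hf : Function.Injective f) (v : β → R) :
    hammingNorm (fun a => v (f a)) ≤ hammingNorm v := by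
  classical
  rw [hammingNorm, hammingNorm, ← Finset.card_image_of_injective _ hf]
  refine Finset.card_le_card fun b hb => ?_
  obtain ⟨a, ha, rfl⟩ := Finset.mem_image.1 hb
  simpa using ha

theorem hammingNorm_add_le [AddMonoid R] (v w : α → R) :
    hammingNorm (v + w) ≤ hammingNorm v + hammingNorm w := by
  classical
  refine le_trans (Finset.card_le_card fun a ha => ?_) (Finset.card_union_le _ _)
  simp only [Finset.mem_filter, Finset.mem_univ, true_and, Finset.mem_union] at ha ⊢
  by_contra! h
  exact ha (by simp [h.1, h.2])

theorem hammingNorm_basisMatrix_mulVec_le [DecidableEq β] (f : α → β) (w : α → ZMod 2) :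
    hammingNorm (basisMatrix f *ᵥ w) ≤ hammingNorm w := by
  classical
  refine le_trans (Finset.card_le_card fun b hb => ?_)
    (Finset.card_image_le (s := Finset.univ.filter fun a => w a ≠ 0) (f := f))
  obtain ⟨a, -, ha⟩ := Finset.exists_ne_zero_of_sum_ne_zero (Finset.mem_filter.1 hb).2
  simp only [basisMatrix, Matrix.of_apply, ite_mul, one_mul, zero_mul, ne_eq, ite_eq_right_iff,
    Classical.not_imp] at ha
  exact Finset.mem_image.2 ⟨a, by simpa using ha.2, ha.1⟩

end HammingNorm

/-! ### Direct sums of codes -/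

theorem Matrix.blockDiagonal'_mulVec_apply {ι R : Type*} [Fintype ι] [DecidableEq ι] [CommRing R]
    {m n : ι → Type*} [∀ j, Fintype (n j)] (M : ∀ j, Matrix (m j) (n j) R) (u : (Σ j, n j) → R)
    (j : ι) (x : m j) :
    (Matrix.blockDiagonal' M *ᵥ u) ⟨j, x⟩ = (M j *ᵥ fun q => u ⟨j, q⟩) x := by
  simp only [Matrix.mulVec, dotProduct, Fintype.sum_sigma]
  rw [Finset.sum_eq_single j]
  · simp only [Matrix.blockDiagonal'_apply_eq]
  · intro k _ hk
    simp [Matrix.blockDiagonal'_apply_ne _ _ _ (Ne.symm hk)]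
  · simp

/-- A nontrivial logical operator of a direct sum of codes restricts to a nontrivial logical operator
of one of them. -/
theorem Matrix.exists_block_of_blockDiagonal' {ι R : Type*} [Fintype ι] [DecidableEq ι] [CommRing R]
    {m m' n : ι → Type*} [∀ j, Fintype (n j)] [∀ j, Fintype (m' j)]
    (M : ∀ j, Matrix (m j) (n j) R) (M' : ∀ j, Matrix (m' j) (n j) R) {u : (Σ j, n j) → R}
    (hu : Matrix.blockDiagonal' M *ᵥ u = 0)
    (hu' : ¬ ∃ y, (Matrix.blockDiagonal' M')ᵀ *ᵥ y = u) :
    ∃ j, (M j *ᵥ fun q => u ⟨j, q⟩) = 0 ∧ ¬ ∃ y, (M' j)ᵀ *ᵥ y = fun q => u ⟨j, q⟩ := by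
  by_contra! hcon
  choose y hy using fun j => hcon j (by
    ext x
    rw [← Matrix.blockDiagonal'_mulVec_apply, hu]
    rfl)
  refine hu' ⟨fun p => y p.1 p.2, ?_⟩
  ext ⟨j, q⟩
  rw [Matrix.blockDiagonal'_transpose, Matrix.blockDiagonal'_mulVec_apply]
  exact congrFun (hy j) q

/-! ### Distance of the deformed code -/

/-! ### Coboundaries in a thickened hypergraph -/

section Thicken

variable {V E : Type*} [Fintype V] [Fintype E] [DecidableEq V] {L : ℕ}

omit [Fintype E] in
theorem thicken_transpose_mulVec_inl (G : Matrix V E (ZMod 2)) (w : V × Fin L → ZMod 2) (x : E)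
    (l : Fin L) : ((thicken G L)ᵀ *ᵥ w) (Sum.inl (x, l)) = (Gᵀ *ᵥ fun v => w (v, l)) x := by
  simp [thicken, Matrix.mulVec, dotProduct, Fintype.sum_prod_type, Matrix.one_apply]

omit [Fintype E] in
theorem thicken_transpose_mulVec_inr (G : Matrix V E (ZMod 2)) (w : V × Fin L → ZMod 2) (v : V)
    (k : Fin (L - 1)) : ((thicken G L)ᵀ *ᵥ w) (Sum.inr (v, k))
      = w (v, ⟨k, by omega⟩) + w (v, ⟨k + 1, by omega⟩) := by
  have hsum : ∀ g : Fin L → ZMod 2, ∑ l, pathIncidence L l k * g l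
      = g ⟨k, by omega⟩ + g ⟨k + 1, by omega⟩ := by
    intro g
    rw [← Finset.sum_pair (a := (⟨k, by omega⟩ : Fin L)) (b := ⟨k + 1, by omega⟩) (f := g)
      (by simp [Fin.ext_iff])]
    rw [← Finset.sum_subset (Finset.subset_univ {⟨k, by omega⟩, ⟨k + 1, by omega⟩})]
    · refine Finset.sum_congr rfl fun l hl => ?_
      have : (l : ℕ) = k ∨ (l : ℕ) = k + 1 := by simpa [Fin.ext_iff] using hl
      simp [pathIncidence, this]
    · intro l _ hl
      have : ¬ ((l : ℕ) = k ∨ (l : ℕ) = k + 1) := by simpa [Fin.ext_iff] using hl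
      simp only [pathIncidence, Matrix.of_apply, if_neg this, zero_mul]
  rw [← hsum fun l => w (v, l)]
  simp only [Matrix.mulVec, dotProduct, Fintype.sum_prod_type, Matrix.transpose_apply, thicken,
    Matrix.fromCols_apply_inr, Matrix.kroneckerMap_apply]
  rw [Finset.sum_eq_single v]
  · simp
  · intro v' _ hv
    simp [Matrix.one_apply_ne hv]
  · simp

-- The path is connected: equality propagates rung by rung from level `0`.
omit [Fintype E] in
theorem eq_of_thicken_transpose_mulVec_inr_eq_zero (G : Matrix V E (ZMod 2))
    (w : V × Fin L → ZMod 2) (v : V)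
    (h : ∀ k, ((thicken G L)ᵀ *ᵥ w) (Sum.inr (v, k)) = 0) (l l' : Fin L) :
    w (v, l) = w (v, l') := by
  have key : ∀ i (hi : i < L), w (v, ⟨i, hi⟩) = w (v, ⟨0, by omega⟩) := by
    intro i
    induction i with
    | zero => exact fun _ => rfl
    | succ i ih =>
      intro hi
      rw [← ih (by omega)]
      have := h ⟨i, by omega⟩
      rw [thicken_transpose_mulVec_inr] at this
      exact (CharTwo.add_eq_zero.1 this).symm
  rw [key l l.2, key l' l'.2]

omit [Fintype E] in
/-- Two levels of `w` differ at most in the rungs of the boundary of `w`. -/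
theorem hammingNorm_level_add_le (G : Matrix V E (ZMod 2)) (w : V × Fin L → ZMod 2) (l l' : Fin L) :
    hammingNorm ((fun v => w (v, l)) + fun v => w (v, l'))
      ≤ hammingNorm fun p => ((thicken G L)ᵀ *ᵥ w) (Sum.inr p) := by
  classical
  -- Every vertex at which the two levels differ has a nonzero rung above it, so projecting the
  -- nonzero rungs to `V` covers these vertices.
  refine le_trans (Finset.card_le_card fun v hv => ?_)
    (Finset.card_image_le (s := Finset.univ.filter fun p : V × Fin (L - 1) =>
      ((thicken G L)ᵀ *ᵥ w) (Sum.inr p) ≠ 0) (f := Prod.fst))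
  by_contra hcon
  refine (Finset.mem_filter.1 hv).2 ?_
  rw [Pi.add_apply, CharTwo.add_eq_zero]
  refine eq_of_thicken_transpose_mulVec_inr_eq_zero G w v (fun k => ?_) l l'
  by_contra hk
  exact hcon (Finset.mem_image.2 ⟨(v, k), by simpa using hk, rfl⟩)

/-- If the parity-check matrix `H` has soundness `κ`, every coboundary in the hypergraph of `H`
thickened at least `κ⁻¹` times is the coboundary of a vector no level of which outweighs it. -/
theorem exists_thicken_transpose_mulVec_level_le {H : Matrix E V (ZMod 2)} {κ : ℝ}
    (hH : ∀ w, ∃ z, H *ᵥ z = 0 ∧ κ * hammingNorm (w + z) ≤ hammingNorm (H *ᵥ w))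
    (hL : 1 ≤ κ * L) (w : V × Fin L → ZMod 2) :
    ∃ w', (thicken Hᵀ L)ᵀ *ᵥ w' = (thicken Hᵀ L)ᵀ *ᵥ w ∧
      ∀ l, hammingNorm (fun v => w' (v, l)) ≤ hammingNorm ((thicken Hᵀ L)ᵀ *ᵥ w) := by
  have hL0 : 0 < L := Nat.pos_of_ne_zero (by rintro rfl; norm_num at hL)
  have : Nonempty (Fin L) := ⟨⟨0, hL0⟩⟩
  choose z hz hzle using fun l => hH fun v => w (v, l)
  -- The lightest level is at most the average: `L * κ` times its weight is at most the total
  -- syndrome weight over all levels, which is the hyperedge part of the coboundary.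
  obtain ⟨k, hk⟩ := Finite.exists_min fun l => hammingNorm ((fun v => w (v, l)) + z l)
  have hκ : 0 ≤ κ := by
    by_contra! h
    have : κ * L ≤ 0 := mul_nonpos_of_nonpos_of_nonneg h.le (Nat.cast_nonneg L)
    linarith
  have hk' : hammingNorm ((fun v => w (v, k)) + z k)
      ≤ hammingNorm fun p => ((thicken Hᵀ L)ᵀ *ᵥ w) (Sum.inl p) := by
    have h1 : (L : ℝ) * (κ * hammingNorm ((fun v => w (v, k)) + z k))
        ≤ ∑ l, (hammingNorm (H *ᵥ fun v => w (v, l)) : ℝ) := by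
      have h := Finset.card_nsmul_le_sum Finset.univ
        (fun l => (hammingNorm (H *ᵥ fun v => w (v, l)) : ℝ))
        (κ * hammingNorm ((fun v => w (v, k)) + z k)) fun l _ =>
          le_trans (mul_le_mul_of_nonneg_left (by exact_mod_cast hk l) hκ) (hzle l)
      rwa [Finset.card_univ, Fintype.card_fin, nsmul_eq_mul] at h
    have h2 : (hammingNorm ((fun v => w (v, k)) + z k) : ℝ)
        ≤ (L : ℝ) * (κ * hammingNorm ((fun v => w (v, k)) + z k)) := by
      rw [← mul_assoc, mul_comm (L : ℝ)]
      exact le_mul_of_one_le_left (Nat.cast_nonneg _) hL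
    have h3 := h2.trans h1
    rw [hammingNorm_prod]
    simp only [thicken_transpose_mulVec_inl, Matrix.transpose_transpose]
    exact_mod_cast h3
  -- The same `z k` is added on every level: hyperedges miss it because it lies in the kernel, rungs
  -- because it is constant along the path.
  refine ⟨w + fun p => z k p.1, ?_, fun l => ?_⟩
  · rw [Matrix.mulVec_add, add_eq_left]
    ext (⟨x, l⟩ | ⟨v, i⟩)
    · rw [thicken_transpose_mulVec_inl, Matrix.transpose_transpose]
      exact congrFun (hz k) x
    · rw [thicken_transpose_mulVec_inr]
      exact CharTwo.add_self_eq_zero _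
  -- Rungs pay for passing from level `l` to level `k`, hyperedges for the weight at level `k`;
  -- these parts of the coboundary are disjoint, so nothing is paid twice.
  · have h : (fun v => (w + fun p : V × Fin L => z k p.1) (v, l))
        = ((fun v => w (v, l)) + fun v => w (v, k)) + ((fun v => w (v, k)) + z k) := by
      ext v
      simp only [Pi.add_apply]
      rw [add_assoc, ← add_assoc (w (v, k)), CharTwo.add_self_eq_zero, zero_add]
    rw [h, hammingNorm_sum, add_comm (hammingNorm _)]
    exact (hammingNorm_add_le _ _).trans (add_le_add (hammingNorm_level_add_le _ w l k) hk')

end Thicken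

/-! ### Logical operators of the deformed code -/

section Deformed

variable {QA XA ZA : Type*} [Fintype QA] [Fintype XA] [DecidableEq QA]
  {A : CSSCode QA XA ZA}
  {ι : Type*} [Fintype ι] [DecidableEq ι] {Q X Z : ι → Type*}
  [∀ j, Fintype (Q j)] [∀ j, Fintype (X j)] [∀ j, Fintype (Z j)]
  [∀ j, DecidableEq (Q j)] [∀ j, DecidableEq (X j)] [∀ j, DecidableEq (Z j)]
  {C : ∀ j, CSSCode (Q j) (X j) (Z j)} {L : ℕ}
  {F : Type*} [Fintype F] {N : Matrix (XA × Fin L ⊕ QA × Fin (L - 1)) F (ZMod 2)}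

theorem CSSCode.le_distZ_iff {Q X Z : Type*} [Fintype Q] [Fintype Z] {C : CSSCode Q X Z} {d : ℕ} :
    (d : ℕ∞) ≤ C.distZ ↔ ∀ v, C.HX *ᵥ v = 0 → (¬ ∃ w, C.HZᵀ *ᵥ w = v) → d ≤ hammingNorm v := by
  simp only [CSSCode.distZ, le_iInf_iff, Nat.cast_le]

theorem CSSCode.le_distX_iff {Q X Z : Type*} [Fintype Q] [Fintype X] {C : CSSCode Q X Z} {d : ℕ} :
    (d : ℕ∞) ≤ C.distX ↔ ∀ u, C.HZ *ᵥ u = 0 → (¬ ∃ w, C.HXᵀ *ᵥ w = u) → d ≤ hammingNorm u := by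
  simp only [CSSCode.distX, le_iInf_iff, Nat.cast_le]

theorem CSSCode.le_distance_iff {Q X Z : Type*} [Fintype Q] [Fintype X] [Fintype Z]
    {C : CSSCode Q X Z} {d : ℕ} :
    (d : ℕ∞) ≤ C.distance ↔ (d : ℕ∞) ≤ C.distX ∧ (d : ℕ∞) ≤ C.distZ := le_min_iff

omit [DecidableEq QA] [Fintype ι] [DecidableEq ι] [∀ j, Fintype (X j)] in
theorem attachQubit_mulVec (f : ∀ j, SubcodeMap A (C j)) (lev : ι → Fin L)
    (w : QA × Fin L → ZMod 2) (j : ι) (q : Q j) :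
    (attachQubit f lev *ᵥ w) ⟨j, q⟩ = (basisMatrix (f j).qubit *ᵥ fun a => w (a, lev j)) q := by
  simp only [Matrix.mulVec, dotProduct, attachQubit, Matrix.of_apply, Fintype.sum_prod_type, ite_mul,
    zero_mul, Finset.sum_ite_eq', Finset.mem_univ, if_true]

theorem IsCycleBasis.exists_mulVec_eq {V E F : Type*} [Fintype E] [Fintype F]
    {G : Matrix V E (ZMod 2)} {N : Matrix E F (ZMod 2)} (hN : IsCycleBasis G N) {z : E → ZMod 2}
    (hz : G *ᵥ z = 0) : ∃ c, N *ᵥ c = z := by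
  have : z ∈ LinearMap.range N.mulVecLin := by rw [hN.2]; exact hz
  exact this

/-- If the block part were a product of `X`-checks, cancelling it would leave a cycle on the new
qubits, which is a product of cycle checks. Neither soundness nor a lower bound on `L` enters. -/
theorem le_distX_deformedCode (f : ∀ j, SubcodeMap A (C j)) (lev : ι → Fin L)
    (hN : IsCycleBasis (thicken A.incidence L) N) {d : ℕ} (hd : ∀ j, (d : ℕ∞) ≤ (C j).distX) :
    (d : ℕ∞) ≤ (deformedCode f lev N hN).distX := by
  rw [CSSCode.le_distX_iff]
  intro v hv hv'
  obtain ⟨u, e, rfl⟩ : ∃ u e, v = Sum.elim u e := ⟨_, _, (Sum.elim_comp_inl_inr v).symm⟩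
  simp only [deformedCode, Matrix.fromBlocks_mulVec, Matrix.fromBlocks_transpose] at hv hv'
  have h1 := congrArg (fun g => g ∘ Sum.inl) hv
  have h2 := congrArg (fun g => g ∘ Sum.inr) hv
  simp only [Sum.elim_comp_inl, Sum.elim_comp_inr, Matrix.zero_mulVec, add_zero] at h1 h2
  obtain ⟨j, hj, hj'⟩ := Matrix.exists_block_of_blockDiagonal' (fun j => (C j).HZ)
    (fun j => (C j).HX) (u := u) h1 (by
      rintro ⟨x, hx⟩
      -- By `attach_comm` the boundary of `(attachXCheck f lev)ᵀ x` is `(attachQubit f lev)ᵀ u`,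
      -- which `h2` matches with the boundary of `e`.
      have hcyc : thicken A.incidence L *ᵥ (e + (attachXCheck f lev)ᵀ *ᵥ x) = 0 := by
        rw [Matrix.mulVec_add, Matrix.mulVec_mulVec, ← Matrix.transpose_transpose (thicken _ _),
          ← Matrix.transpose_mul, ← attach_comm, Matrix.transpose_mul, ← Matrix.mulVec_mulVec, hx,
          Matrix.transpose_transpose, add_comm]
        exact h2
      obtain ⟨c, hc⟩ := hN.exists_mulVec_eq hcyc
      refine hv' ⟨Sum.elim x c, ?_⟩
      simp only [Sum.elim_comp_inl, Sum.elim_comp_inr, Matrix.transpose_zero, Matrix.zero_mulVec,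
        add_zero, Matrix.transpose_transpose, hx, hc]
      congr 1
      ext p
      simp only [Pi.add_apply]
      rw [add_comm (e p), ← add_assoc, CharTwo.add_self_eq_zero, zero_add])
  refine (CSSCode.le_distX_iff.1 (hd j) _ hj hj').trans ?_
  exact hammingNorm_le_of_injective (f := Sum.inl ∘ Sigma.mk j)
    (Sum.inl_injective.comp sigma_mk_injective) (Sum.elim u e)

-- The cycle checks make `e` a coboundary, so vertex checks clear it. Block `j` then receives only
-- the level `lev j` of the clearing vector, of weight at most `|e|`, and one nontrivial block
-- suffices for the bound.
omit [∀ j, Fintype (X j)] in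
theorem le_distZ_deformedCode (f : ∀ j, SubcodeMap A (C j)) (lev : ι → Fin L)
    (hN : IsCycleBasis (thicken A.incidence L) N) {κ : ℝ}
    (hA : ∀ w, ∃ z, A.HX *ᵥ z = 0 ∧ κ * hammingNorm (w + z) ≤ hammingNorm (A.HX *ᵥ w))
    (hL : 1 ≤ κ * L) {d : ℕ} (hd : ∀ j, (d : ℕ∞) ≤ (C j).distZ) :
    (d : ℕ∞) ≤ (deformedCode f lev N hN).distZ := by
  rw [CSSCode.le_distZ_iff]
  intro v hv hv'
  obtain ⟨u, e, rfl⟩ : ∃ u e, v = Sum.elim u e := ⟨_, _, (Sum.elim_comp_inl_inr v).symm⟩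
  simp only [deformedCode, Matrix.fromBlocks_mulVec, Matrix.fromBlocks_transpose] at hv hv'
  have h1 := congrArg (fun g => g ∘ Sum.inl) hv
  have h2 := congrArg (fun g => g ∘ Sum.inr) hv
  simp only [Sum.elim_comp_inl, Sum.elim_comp_inr, Matrix.zero_mulVec, zero_add] at h1 h2
  obtain ⟨w₀, hw₀⟩ := (thicken A.incidence L).exists_transpose_mulVec_eq e (by
    intro z hz
    obtain ⟨c, rfl⟩ := hN.exists_mulVec_eq hz
    rw [Matrix.dotProduct_mulVec, ← Matrix.mulVec_transpose, show Nᵀ *ᵥ e = 0 from h2,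
      zero_dotProduct])
  obtain ⟨w, hw, hwle⟩ := exists_thicken_transpose_mulVec_level_le hA hL w₀
  change (thicken A.incidence L)ᵀ *ᵥ w = (thicken A.incidence L)ᵀ *ᵥ w₀ at hw
  change ∀ l, _ ≤ hammingNorm ((thicken A.incidence L)ᵀ *ᵥ w₀) at hwle
  rw [hw₀] at hw hwle
  obtain ⟨j, hj, hj'⟩ := Matrix.exists_block_of_blockDiagonal' (fun j => (C j).HX)
    (fun j => (C j).HZ) (u := u + attachQubit f lev *ᵥ w) (by
      rw [Matrix.mulVec_add, Matrix.mulVec_mulVec, attach_comm, ← Matrix.mulVec_mulVec, hw]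
      exact h1) (by
      rintro ⟨y, hy⟩
      refine hv' ⟨Sum.elim y w, ?_⟩
      simp only [Sum.elim_comp_inl, Sum.elim_comp_inr, Matrix.transpose_zero, Matrix.zero_mulVec,
        zero_add, Matrix.transpose_transpose, hy, hw]
      congr 1
      ext p
      simp only [Pi.add_apply]
      rw [add_assoc, CharTwo.add_self_eq_zero, add_zero])
  refine (CSSCode.le_distZ_iff.1 (hd j) _ hj hj').trans ?_
  have hsplit : (fun q => (u + attachQubit f lev *ᵥ w) ⟨j, q⟩)
      = (fun q => u ⟨j, q⟩) + basisMatrix (f j).qubit *ᵥ fun a => w (a, lev j) := by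
    ext q
    rw [Pi.add_apply, Pi.add_apply, attachQubit_mulVec]
  rw [hsplit, hammingNorm_sum]
  refine (hammingNorm_add_le _ _).trans (add_le_add ?_ ?_)
  · exact hammingNorm_le_of_injective sigma_mk_injective u
  · exact (hammingNorm_basisMatrix_mulVec_le _ _).trans (hwle _)

end Deformed

/-! ### Space cost -/

namespace CSSCode

variable {Q X Z : Type*} [Fintype Q] [Fintype X] [Fintype Z]

/-- On an unchecked qubit, a single `Z` would be a nontrivial logical operator of weight one. -/
theorem everyQubitChecked_of_two_le_distance {C : CSSCode Q X Z} (h : 2 ≤ C.distance) :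
    C.EveryQubitChecked := by
  classical
  intro q
  by_contra! hq
  have hd : ((2 : ℕ) : ℕ∞) ≤ C.distZ := (C.le_distance_iff (d := 2)).1 h |>.2
  have := le_distZ_iff.1 hd (Pi.single q 1) (by ext i; simpa using hq.1 i) (by
    rintro ⟨w, hw⟩
    have := congrFun hw q
    rw [Pi.single_eq_same, Matrix.mulVec, dotProduct, Finset.sum_eq_zero] at this
    · exact zero_ne_one this
    · intro i _
      rw [Matrix.transpose_apply, hq.2 i, zero_mul])
  have h1 : hammingNorm (Pi.single q 1 : Q → ZMod 2) ≤ 1 := by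
    rw [hammingNorm]
    refine (Finset.card_le_card (t := {q}) fun p hp => ?_).trans_eq (Finset.card_singleton q)
    by_contra hne
    exact (Finset.mem_filter.1 hp).2 (Pi.single_eq_of_ne (by simpa using hne) 1)
  omega

theorem IsSparse.card_qubits_le {C : CSSCode Q X Z} {σ : ℕ} (h : C.IsSparse σ)
    (hC : C.EveryQubitChecked) : Fintype.card Q ≤ (Fintype.card X + Fintype.card Z) * σ := by
  classical
  have hcover : (Finset.univ : Finset Q) ⊆ (Finset.univ : Finset (X ⊕ Z)).biUnion fun i =>
      Finset.univ.filter fun q => Sum.elim C.HX C.HZ i q ≠ 0 := by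
    intro q _
    simp only [Finset.mem_biUnion, Finset.mem_filter, Finset.mem_univ, true_and]
    rcases hC q with ⟨i, hi⟩ | ⟨i, hi⟩
    · exact ⟨Sum.inl i, hi⟩
    · exact ⟨Sum.inr i, hi⟩
  refine (Finset.card_le_card hcover).trans ?_
  rw [← Fintype.card_sum]
  refine Finset.card_biUnion_le_card_mul _ _ _ fun i _ => ?_
  rcases i with i | i
  · exact h.1 i
  · exact h.2.2.1 i

end CSSCode

/-- The error on `q` alone has nonzero syndrome, so it is at distance at least one from the kernel,
yet it violates at most `σ` checks. -/
theorem le_of_classical_soundness {V E : Type*} [Fintype V] [Fintype E] {H : Matrix E V (ZMod 2)}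
    {κ : ℝ} (hκ : 0 ≤ κ)
    (hH : ∀ w, ∃ z, H *ᵥ z = 0 ∧ κ * hammingNorm (w + z) ≤ hammingNorm (H *ᵥ w)) {σ : ℕ}
    {q : V} (hσ : hammingNorm (Hᵀ q) ≤ σ) {i : E} (hi : H i q ≠ 0) : κ ≤ σ := by
  classical
  obtain ⟨z, hz, hle⟩ := hH (Pi.single q 1)
  have hcol : H *ᵥ Pi.single q 1 = Hᵀ q := by
    rw [Matrix.mulVec_single_one]; rfl
  have hne : Pi.single q 1 + z ≠ 0 := by
    intro h0
    have := congrFun (congrArg (H *ᵥ ·) h0) i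
    simp only [Matrix.mulVec_add, hz, hcol, Matrix.mulVec_zero, add_zero] at this
    exact hi this
  have h1 : (1 : ℝ) ≤ hammingNorm (Pi.single q 1 + z) := by
    exact_mod_cast hammingNorm_pos_iff.2 hne
  rw [hcol] at hle
  exact (le_mul_of_one_le_right hκ h1).trans (hle.trans (by exact_mod_cast hσ))

theorem IsCycleBasis.card_le {V E F : Type*} [Fintype E] [Fintype F]
    {G : Matrix V E (ZMod 2)} {N : Matrix E F (ZMod 2)} (hN : IsCycleBasis G N) :
    Fintype.card F ≤ Fintype.card E := by
  have := LinearMap.finrank_le_finrank_of_injective (f := N.mulVecLin) hN.1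
  simpa using this

theorem mainTheorem12 (σ : ℕ) :
    ∃ c : ℝ, 0 < c ∧
      ∀ (QA XA ZA : Type*) [Fintype QA] [Fintype XA] [Fintype ZA]
        [DecidableEq QA]
        (A : CSSCode QA XA ZA) (ω : ℕ) (ρ : ℝ),
        0 < ρ → A.IsLocallyTestable ω ρ →
        0 < Fintype.card QA → 0 < Fintype.card XA + Fintype.card ZA →
        -- the distance is preserved
        (∀ (ι : Type*) [Fintype ι] [DecidableEq ι] (Q X Z : ι → Type*)
          [∀ j, Fintype (Q j)] [∀ j, Fintype (X j)] [∀ j, Fintype (Z j)]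
          [∀ j, DecidableEq (Q j)] [∀ j, DecidableEq (X j)] [∀ j, DecidableEq (Z j)]
          (C : ∀ j, CSSCode (Q j) (X j) (Z j)) (f : ∀ j, SubcodeMap A (C j))
          (d L : ℕ) (lev : ι → Fin L) (F : Type*) [Fintype F]
          (N : Matrix (XA × Fin L ⊕ QA × Fin (L - 1)) F (ZMod 2))
          (hN : IsCycleBasis (thicken A.incidence L) N),
          2 * (Fintype.card QA : ℝ) / (ρ * ((Fintype.card XA + Fintype.card ZA : ℕ) : ℝ)) ≤ L →
          (∀ j, (d : ℕ∞) ≤ (C j).distance) →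
          (d : ℕ∞) ≤ (deformedCode f lev N hN).distance) ∧
        -- the space cost: new data qubits, vertex checks and cycle checks
        (A.IsSparse σ → (2 ≤ A.distance ∨ A.EveryQubitChecked) →
          ∀ (L : ℕ),
          L = ⌈2 * (Fintype.card QA : ℝ) /
            (ρ * ((Fintype.card XA + Fintype.card ZA : ℕ) : ℝ))⌉₊ →
          ∀ (F : Type*) [Fintype F]
          (N : Matrix (XA × Fin L ⊕ QA × Fin (L - 1)) F (ZMod 2)),
          IsCycleBasis (thicken A.incidence L) N →
          ((Fintype.card (XA × Fin L ⊕ QA × Fin (L - 1)) + Fintype.card (QA × Fin L)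
              + Fintype.card F : ℕ) : ℝ)
            ≤ c * (Fintype.card QA / ρ)) := by
  -- The first factor counts new objects in units of `m L`; the second bounds `m L` in units of `n /
  -- ρ`.
  refine ⟨(2 + 3 * σ) * (2 + σ), by positivity, ?_⟩
  intro QA XA ZA _ _ _ _ A ω ρ hρ hA hn hm
  set m : ℕ := Fintype.card XA + Fintype.card ZA with hmdef
  set n : ℕ := Fintype.card QA with hndef
  have hm' : (0 : ℝ) < m := by exact_mod_cast hm
  have hn' : (0 : ℝ) < n := by exact_mod_cast hn
  set κ : ℝ := ρ * m / n with hκdef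
  have hκ : 0 < κ := by positivity
  have hscale : ∀ a b : ℝ, ρ / n * a ≤ b / m → κ * a ≤ b := fun a b h => by
    have := mul_le_mul_of_nonneg_right h hm'.le
    rw [div_mul_cancel₀ _ hm'.ne'] at this
    calc κ * a = ρ / n * a * m := by rw [hκdef]; ring
      _ ≤ b := this
  have hX : ∀ w, ∃ z, A.HX *ᵥ z = 0 ∧ κ * hammingNorm (w + z) ≤ hammingNorm (A.HX *ᵥ w) :=
    fun w => (CSSCode.classical_soundness_HX hA.2.2 hρ.le w).imp fun z h => ⟨h.1, hscale _ _ h.2⟩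
  have hZ : ∀ w, ∃ z, A.HZ *ᵥ z = 0 ∧ κ * hammingNorm (w + z) ≤ hammingNorm (A.HZ *ᵥ w) :=
    fun w => (CSSCode.classical_soundness_HZ hA.2.2 hρ.le w).imp fun z h => ⟨h.1, hscale _ _ h.2⟩
  refine ⟨?_, ?_⟩
  · intro ι _ _ Q X Z _ _ _ _ _ _ C f d L lev F _ N hN hL hd
    -- The assumption gives `2 ≤ κ * L`; the averaging needs only half of it.
    have hκL : 1 ≤ κ * L := by
      have h := mul_le_mul_of_nonneg_left hL hκ.le
      have h2 : κ * (2 * n / (ρ * m)) = 2 := by rw [hκdef]; field_simp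
      linarith
    exact CSSCode.le_distance_iff.2
      ⟨le_distX_deformedCode f lev hN fun j => (CSSCode.le_distance_iff.1 (hd j)).1,
        le_distZ_deformedCode f lev hN hX hκL fun j => (CSSCode.le_distance_iff.1 (hd j)).2⟩
  · intro hsparse hchecked L hL F _ N hN
    have hcheck : A.EveryQubitChecked :=
      hchecked.elim CSSCode.everyQubitChecked_of_two_le_distance id
    have hnm : n ≤ m * σ := hsparse.card_qubits_le hcheck
    -- A qubit may be seen by checks of one type only, hence the soundness of `HZ` as well as of
    -- `HX`.
    have hκσ : κ ≤ σ := by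
      obtain ⟨q⟩ : Nonempty QA := Fintype.card_pos_iff.1 hn
      rcases hcheck q with ⟨i, hi⟩ | ⟨i, hi⟩
      · exact le_of_classical_soundness hκ.le hX (hsparse.2.1 q) hi
      · exact le_of_classical_soundness hκ.le hZ (hsparse.2.2.2 q) hi
    have hmσ : (m : ℝ) ≤ σ * (n / ρ) := by
      rw [hκdef, div_le_iff₀ hn'] at hκσ
      rw [← mul_div_assoc, le_div_iff₀ hρ]
      linarith
    have hLle : (L : ℝ) ≤ 2 * n / (ρ * m) + 1 := by
      rw [hL]
      exact (Nat.ceil_lt_add_one (by positivity)).le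
    -- Rounding `L` up costs at most one level, that is, `m` more in `m * L`, which `hmσ` absorbs.
    have hmL : (m : ℝ) * L ≤ (2 + σ) * (n / ρ) := by
      have h := mul_le_mul_of_nonneg_left hLle hm'.le
      have h2 : (m : ℝ) * (2 * n / (ρ * m) + 1) = 2 * (n / ρ) + m := by field_simp
      linarith
    -- Hyperedges number at most `m L + n L`, independent cycles no more than hyperedges, vertices
    -- `n L`; then `n ≤ m σ`.
    have hcount : Fintype.card (XA × Fin L ⊕ QA × Fin (L - 1)) + Fintype.card (QA × Fin L)
        + Fintype.card F ≤ (2 + 3 * σ) * (m * L) := by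
      have hF := hN.card_le
      simp only [Fintype.card_sum, Fintype.card_prod, Fintype.card_fin, ← hndef] at hF ⊢
      have h1 : Fintype.card XA * L ≤ m * L := Nat.mul_le_mul_right L (Nat.le_add_right _ _)
      have h2 : n * (L - 1) ≤ n * L := Nat.mul_le_mul_left n (Nat.sub_le L 1)
      have h3 : n * L ≤ m * σ * L := Nat.mul_le_mul_right L hnm
      rw [show (2 + 3 * σ) * (m * L) = 2 * (m * L) + 3 * (m * σ * L) by ring]
      omega
    calc _ ≤ (((2 + 3 * σ) * (m * L) : ℕ) : ℝ) := by exact_mod_cast hcount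
      _ = (2 + 3 * σ) * ((m : ℝ) * L) := by push_cast; ring
      _ ≤ (2 + 3 * σ) * ((2 + σ) * (n / ρ)) := mul_le_mul_of_nonneg_left hmL (by positivity)
      _ = _ := by ring
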